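/- Let $\mathbb{T}$ be the unit circle with normalized Lebesgue measure and let $z$ denote the identity function on $\mathbb{T}$. For $p\in\{2,\infty\}$ let $H^p_r$ be the real vector space of all $f\in L^p(\mathbb{T})$ whose Fourier coefficients $\hat f(n)$ are real for all $n\in\mathbb{Z}$ and zero for all $n<0$. Let $\mathcal{M}$ be a closed real-linear subspace of $H^2_r$ such that $z^2\mathcal{M}\subseteq\mathcal{M}$ and $z^3\mathcal{M}\subseteq\mathcal{M}$, but $z\mathcal{M}\not\subseteq\mathcal{M}$. Then there exist a real scalar $c$ and an inner function $\phi\in H^\infty_r$ (that is, $\phi\in H^\infty_r$ with $|\phi|=1$ almost everywhere on $\mathbb{T}$) such that \[ \mathcal{M}=\phi\bigl([1+cz]\oplus z^2H^2_r\bigr), \] where $[1+cz]=\{a(1+cz): a\in\mathbb{R}\}$ is the real span of $1+cz$ and $\oplus$ denotes an orthogonal direct sum in $L^2(\mathbb{T})$. -/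

import Mathlib

open MeasureTheory AddCircle
open scoped ENNReal

noncomputable section

/-- `L^p(𝕋)`: complex `L^p` functions on the circle, modelled as `ℝ / ℤ` with normalized Haar
measure. The point `t` of `ℝ / ℤ` stands for `e^{2πit}`, so `fourier n` is the function `z ^ n`. -/
abbrev CircleLp (p : ℝ≥0∞) : Type :=
  Lp ℂ p (haarAddCircle : Measure UnitAddCircle)

namespace CircleLp

theorem integrable {p : ℝ≥0∞} [hp : Fact (1 ≤ p)] (f : CircleLp p) :
    Integrable f (haarAddCircle : Measure UnitAddCircle) :=
  (Lp.memLp f).integrable hp.out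

theorem fourierCoeff_add {p : ℝ≥0∞} [Fact (1 ≤ p)] (f g : CircleLp p) (n : ℤ) :
    fourierCoeff (f + g : CircleLp p) n = fourierCoeff f n + fourierCoeff g n := by
  rw [fourierCoeff_congr_ae (Lp.coeFn_add f g), fourierCoeff.add f.integrable g.integrable]
  rfl

theorem fourierCoeff_zero {p : ℝ≥0∞} (n : ℤ) : fourierCoeff (0 : CircleLp p) n = 0 := by
  rw [fourierCoeff_congr_ae (Lp.coeFn_zero ℂ p haarAddCircle)]
  simp [fourierCoeff]

theorem fourierCoeff_smul {p : ℝ≥0∞} (c : ℂ) (f : CircleLp p) (n : ℤ) :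
    fourierCoeff (c • f : CircleLp p) n = c * fourierCoeff f n := by
  rw [fourierCoeff_congr_ae (Lp.coeFn_smul c f), fourierCoeff.const_smul, smul_eq_mul]

theorem fourierCoeff_real_smul {p : ℝ≥0∞} (c : ℝ) (f : CircleLp p) (n : ℤ) :
    fourierCoeff (c • f : CircleLp p) n = c * fourierCoeff f n := by
  have h : (c • f : CircleLp p) = (c : ℂ) • f := by
    apply Lp.ext
    filter_upwards [Lp.coeFn_smul c f, Lp.coeFn_smul (c : ℂ) f] with x h1 h2
    rw [h1, h2, Pi.smul_apply, Pi.smul_apply, Complex.real_smul, smul_eq_mul]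
  rw [h, fourierCoeff_smul]

end CircleLp

/-- The Hardy space `H^p(𝕋)`: the functions in `L^p(𝕋)` whose negative Fourier coefficients
vanish. -/
def hardySpace (p : ℝ≥0∞) [Fact (1 ≤ p)] : Submodule ℂ (CircleLp p) where
  carrier := {f | ∀ n : ℤ, n < 0 → fourierCoeff f n = 0}
  add_mem' {f g} hf hg n hn := by
    rw [CircleLp.fourierCoeff_add, hf n hn, hg n hn, add_zero]
  zero_mem' n _ := CircleLp.fourierCoeff_zero n
  smul_mem' c f hf n hn := by
    rw [CircleLp.fourierCoeff_smul, hf n hn, mul_zero]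

/-- `L^p_r(𝕋)`: the real vector space of functions in `L^p(𝕋)` all of whose Fourier coefficients
are real. -/
def realLp (p : ℝ≥0∞) [Fact (1 ≤ p)] : Submodule ℝ (CircleLp p) where
  carrier := {f | ∀ n : ℤ, (fourierCoeff f n).im = 0}
  add_mem' {f g} hf hg n := by
    rw [CircleLp.fourierCoeff_add, Complex.add_im, hf n, hg n, add_zero]
  zero_mem' n := by rw [CircleLp.fourierCoeff_zero, Complex.zero_im]
  smul_mem' c f hf n := by
    rw [CircleLp.fourierCoeff_real_smul, Complex.im_ofReal_mul, hf n, mul_zero]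

/-- `H^p_r(𝕋) = L^p_r(𝕋) ∩ H^p(𝕋)`. -/
def realHardySpace (p : ℝ≥0∞) [Fact (1 ≤ p)] : Submodule ℝ (CircleLp p) :=
  realLp p ⊓ (hardySpace p).restrictScalars ℝ

/-- An inner function: an element of `H^∞(𝕋)` that is unimodular almost everywhere. -/
def IsInnerFunction (φ : CircleLp ∞) : Prop :=
  φ ∈ hardySpace ∞ ∧ ∀ᵐ t ∂(haarAddCircle : Measure UnitAddCircle), ‖φ t‖ = 1

/-- Pointwise multiplication `f ↦ φ f` of `L²(𝕋)` by `φ ∈ L^∞(𝕋)`, as a real-linear map. -/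
def mulL2 (φ : CircleLp ∞) : CircleLp 2 →ₗ[ℝ] CircleLp 2 where
  toFun f := φ • f
  map_add' f g := Lp.add_smul φ f g
  map_smul' c f := (Lp.smul_comm c φ f).symm

/-- The function `z ^ n` as an element of `L^p(𝕋)`. -/
def zPow (p : ℝ≥0∞) [Fact (1 ≤ p)] (n : ℤ) : CircleLp p :=
  fourierLp p n

end

/-! The space M is trapped between two spaces of Beurling type. The closure N of M + zM is
z-invariant, and invariance of M under z² and z³ gives z²N ⊆ M ⊆ N. The real Beurling theorem
(`exists_inner_eq_map_realHardySpace`) writes N = φH²_r, so φz²H²_r ⊆ M ⊆ φH²_r, and M is determined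
by its image in a quotient spanned by the classes of φ and φz. Failure of z-invariance provides m =
φ(a + bz + z²g) in M with zm ∉ M. Modulo φz²H²_r, zm is aφz, so a ≠ 0 and φz ∉ M. The image of M is
therefore the line spanned by 1 + (b/a)z. Beurling's theorem itself rests on a unit vector u of N
orthogonal to zN: it is orthogonal to all z^n u with n ≠ 0, which forces |u| = 1
(`ae_norm_eq_one_of_inner_eq_zero`). -/

/-! ### Multiplication operators and Fourier coefficients on L². -/

theorem coeFn_mulL2 (φ : CircleLp ∞) (f : CircleLp 2) :
    mulL2 φ f =ᵐ[haarAddCircle] fun t => φ t * f t :=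
  Lp.coeFn_lpSMul φ f

theorem coeFn_zPow (p : ℝ≥0∞) [Fact (1 ≤ p)] (n : ℤ) :
    zPow p n =ᵐ[haarAddCircle] fourier n :=
  coeFn_fourierLp p n

theorem continuous_mulL2 (φ : CircleLp ∞) : Continuous (mulL2 φ) :=
  AddMonoidHomClass.continuous_of_bound (mulL2 φ) ‖φ‖ fun f => Lp.norm_smul_le φ f

theorem mulL2_comm (φ ψ : CircleLp ∞) (f : CircleLp 2) :
    mulL2 φ (mulL2 ψ f) = mulL2 ψ (mulL2 φ f) := by
  apply Lp.ext
  filter_upwards [coeFn_mulL2 φ (mulL2 ψ f), coeFn_mulL2 ψ (mulL2 φ f), coeFn_mulL2 φ f,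
    coeFn_mulL2 ψ f] with t h1 h2 h3 h4
  rw [h1, h2, h3, h4]
  ring

theorem mulL2_zPow_mulL2_zPow (m n : ℤ) (f : CircleLp 2) :
    mulL2 (zPow ∞ m) (mulL2 (zPow ∞ n) f) = mulL2 (zPow ∞ (m + n)) f := by
  apply Lp.ext
  filter_upwards [coeFn_mulL2 (zPow ∞ m) (mulL2 (zPow ∞ n) f), coeFn_mulL2 (zPow ∞ (m + n)) f,
    coeFn_mulL2 (zPow ∞ n) f, coeFn_zPow ∞ m, coeFn_zPow ∞ n, coeFn_zPow ∞ (m + n)]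
    with t h1 h2 h3 h4 h5 h6
  rw [h1, h2, h3, h4, h5, h6, fourier_add]
  ring

theorem mulL2_zPow_zero (f : CircleLp 2) : mulL2 (zPow ∞ 0) f = f := by
  apply Lp.ext
  filter_upwards [coeFn_mulL2 (zPow ∞ 0) f, coeFn_zPow ∞ 0] with t h1 h2
  rw [h1, h2, fourier_zero, one_mul]

theorem mulL2_zPow_zPow (m n : ℤ) : mulL2 (zPow ∞ m) (zPow 2 n) = zPow 2 (m + n) := by
  apply Lp.ext
  filter_upwards [coeFn_mulL2 (zPow ∞ m) (zPow 2 n), coeFn_zPow ∞ m, coeFn_zPow 2 n,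
    coeFn_zPow 2 (m + n)] with t h1 h2 h3 h4
  rw [h1, h2, h3, h4, fourier_add]

theorem fourierCoeff_eq_inner (f : CircleLp 2) (n : ℤ) :
    fourierCoeff f n = inner ℂ (zPow 2 n) f := by
  rw [← fourierBasis_repr, HilbertBasis.repr_apply_apply, coe_fourierBasis]
  rfl

theorem CircleLp.real_smul_eq_coe_smul {p : ℝ≥0∞} (c : ℝ) (f : CircleLp p) :
    c • f = (c : ℂ) • f := by
  apply Lp.ext
  filter_upwards [Lp.coeFn_smul c f, Lp.coeFn_smul (c : ℂ) f] with x h1 h2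
  rw [h1, h2, Pi.smul_apply, Pi.smul_apply, Complex.real_smul, smul_eq_mul]

theorem CircleLp.ext_fourierCoeff {f g : CircleLp 2}
    (h : ∀ n, fourierCoeff f n = fourierCoeff g n) : f = g := by
  apply fourierBasis.repr.injective
  ext n
  rw [fourierBasis_repr, fourierBasis_repr, h]

theorem inner_mulL2_of_norm_eq_one {φ : CircleLp ∞}
    (hφ : ∀ᵐ t ∂(haarAddCircle : Measure UnitAddCircle), ‖φ t‖ = 1) (f g : CircleLp 2) :
    inner ℂ (mulL2 φ f) (mulL2 φ g) = inner ℂ f g := by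
  rw [L2.inner_def, L2.inner_def]
  apply integral_congr_ae
  filter_upwards [hφ, coeFn_mulL2 φ f, coeFn_mulL2 φ g] with t h1 h2 h3
  have h4 : φ t * (starRingEnd ℂ) (φ t) = 1 := by
    rw [Complex.mul_conj, Complex.normSq_eq_norm_sq, h1]; simp
  rw [h2, h3, RCLike.inner_apply, RCLike.inner_apply, map_mul]
  linear_combination (g t * (starRingEnd ℂ) (f t)) * h4

theorem norm_zPow_apply (n : ℤ) :
    ∀ᵐ t ∂(haarAddCircle : Measure UnitAddCircle), ‖zPow ∞ n t‖ = 1 := by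
  filter_upwards [coeFn_zPow ∞ n] with t h
  rw [h, fourier_apply, Circle.norm_coe]

theorem inner_mulL2_zPow (m : ℤ) (f g : CircleLp 2) :
    inner ℂ f (mulL2 (zPow ∞ m) g) = inner ℂ (mulL2 (zPow ∞ (-m)) f) g := by
  rw [← inner_mulL2_of_norm_eq_one (norm_zPow_apply (-m)) f, mulL2_zPow_mulL2_zPow,
    neg_add_cancel, mulL2_zPow_zero]

theorem fourierCoeff_mulL2_zPow (m : ℤ) (f : CircleLp 2) (k : ℤ) :
    fourierCoeff (mulL2 (zPow ∞ m) f) k = fourierCoeff f (k - m) := by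
  rw [fourierCoeff_eq_inner, fourierCoeff_eq_inner, inner_mulL2_zPow, mulL2_zPow_zPow,
    neg_add_eq_sub]

theorem fourierCoeff_zPow (n k : ℤ) :
    fourierCoeff (zPow 2 n : CircleLp 2) k = if k = n then 1 else 0 := by
  rw [fourierCoeff_eq_inner]
  exact orthonormal_iff_ite.mp orthonormal_fourier k n

theorem mem_realHardySpace {p : ℝ≥0∞} [Fact (1 ≤ p)] {f : CircleLp p} :
    f ∈ realHardySpace p ↔
      (∀ n, (fourierCoeff f n).im = 0) ∧ ∀ n < 0, fourierCoeff f n = 0 :=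
  Iff.rfl

theorem zPow_mem_realHardySpace {n : ℤ} (hn : 0 ≤ n) : zPow 2 n ∈ realHardySpace 2 := by
  refine mem_realHardySpace.mpr ⟨fun k => ?_, fun k hk => ?_⟩
  · rw [fourierCoeff_zPow]; split_ifs <;> simp
  · rw [fourierCoeff_zPow, if_neg (by omega)]

theorem mulL2_zPow_mem_realHardySpace {m : ℤ} (hm : 0 ≤ m) {f : CircleLp 2}
    (hf : f ∈ realHardySpace 2) : mulL2 (zPow ∞ m) f ∈ realHardySpace 2 := by
  rw [mem_realHardySpace] at hf ⊢
  refine ⟨fun k => ?_, fun k hk => ?_⟩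
  · rw [fourierCoeff_mulL2_zPow]; exact hf.1 _
  · rw [fourierCoeff_mulL2_zPow]; exact hf.2 _ (by omega)

/-- By Parseval the inner product is a sum of products of real coefficients. This upgrades
orthogonality for the real inner product to orthogonality for the complex one. -/
theorem inner_im_eq_zero {f g : CircleLp 2} (hf : ∀ n, (fourierCoeff f n).im = 0)
    (hg : ∀ n, (fourierCoeff g n).im = 0) : (inner ℂ f g).im = 0 := by
  have h := Complex.hasSum_im (fourierBasis.hasSum_inner_mul_inner f g)
  refine h.unique ?_
  convert! hasSum_zero using 2 with n
  have h1 := hf n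
  have h2 := hg n
  rw [← fourierBasis_repr, HilbertBasis.repr_apply_apply] at h1 h2
  rw [← inner_conj_symm f, Complex.mul_im, Complex.conj_im, h1, h2]
  simp

theorem realInner_eq_re (f g : CircleLp 2) : inner ℝ f g = (inner ℂ f g).re := by
  rw [L2.inner_def, L2.inner_def, ← RCLike.re_eq_complex_re,
    ← integral_re (L2.integrable_inner f g)]
  rfl

theorem isClosed_realHardySpace : IsClosed (realHardySpace 2 : Set (CircleLp 2)) := by
  have hc (n : ℤ) : Continuous fun f : CircleLp 2 => fourierCoeff f n := by
    simp_rw [fourierCoeff_eq_inner]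
    fun_prop
  have : (realHardySpace 2 : Set (CircleLp 2)) =
      (⋂ n, {f : CircleLp 2 | (fourierCoeff f n).im = 0}) ∩
        ⋂ n, ⋂ (_ : n < 0), {f : CircleLp 2 | fourierCoeff f n = 0} := by
    ext f
    simp [mem_realHardySpace]
  rw [this]
  refine (isClosed_iInter fun n => ?_).inter (isClosed_iInter fun n => isClosed_iInter fun _ => ?_)
  · exact isClosed_eq (Complex.continuous_im.comp (hc n)) continuous_const
  · exact isClosed_eq (hc n) continuous_const

/-! ### Unimodularity from orthogonality. -/

/-- The hypotheses say that |f|² dμ and Haar measure μ have the same Fourier coefficients.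
Trigonometric polynomials are dense in the continuous functions, so the two finite measures coincide
and the density |f|² is 1 almost everywhere. -/
theorem ae_norm_eq_one_of_inner_eq_zero {f : CircleLp 2} (hf : ‖f‖ = 1)
    (h : ∀ n : ℤ, n ≠ 0 → inner ℂ f (mulL2 (zPow ∞ n) f) = 0) :
    ∀ᵐ t ∂(haarAddCircle : Measure UnitAddCircle), ‖f t‖ = 1 := by
  set w : UnitAddCircle → NNReal := fun t => ‖f t‖₊ ^ 2 with hw
  have hwm : Measurable w := (Lp.stronglyMeasurable f).measurable.nnnorm.pow_const 2
  set ν : Measure UnitAddCircle := haarAddCircle.withDensity fun t => (w t : ℝ≥0∞) with hν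
  have hint : Integrable (fun t => ‖f t‖ ^ 2) (haarAddCircle : Measure UnitAddCircle) :=
    (memLp_two_iff_integrable_sq_norm (Lp.aestronglyMeasurable f)).mp (Lp.memLp f)
  have hfin : ∫⁻ t, (w t : ℝ≥0∞) ∂(haarAddCircle : Measure UnitAddCircle) ≠ ∞ := by
    have h2 := hint.2
    rw [hasFiniteIntegral_iff_enorm] at h2
    convert! h2.ne using 3 with t
    simp [hw, enorm_eq_nnnorm]
  have : IsFiniteMeasure ν := isFiniteMeasure_withDensity hfin
  have hmul (g : UnitAddCircle → ℂ) : ∫ t, g t ∂ν = ∫ t, (‖f t‖ ^ 2 : ℝ) * g t ∂haarAddCircle := by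
    rw [hν, integral_withDensity_eq_integral_smul hwm]
    refine integral_congr_ae (Filter.Eventually.of_forall fun t => ?_)
    simp [hw, NNReal.smul_def]
  have hfour (n : ℤ) :
      ∫ t, fourier n t ∂ν = ∫ t, fourier n t ∂(haarAddCircle : Measure UnitAddCircle) := by
    have h1 : ∫ t, fourier n t ∂ν = inner ℂ f (mulL2 (zPow ∞ n) f) := by
      rw [hmul, L2.inner_def]
      apply integral_congr_ae
      filter_upwards [coeFn_mulL2 (zPow ∞ n) f, coeFn_zPow ∞ n] with t h1 h2
      rw [h1, h2, RCLike.inner_apply, mul_assoc, Complex.mul_conj, Complex.normSq_eq_norm_sq,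
        mul_comm]
    have h2 : ∫ t, (fourier n t : ℂ) ∂(haarAddCircle : Measure UnitAddCircle) =
        if n = 0 then 1 else 0 := by
      have := fourierCoeff_zPow n 0
      rw [fourierCoeff_congr_ae (coeFn_zPow 2 n)] at this
      simpa [fourierCoeff, eq_comm] using this
    rw [h1, h2]
    split_ifs with hn
    · rw [hn, mulL2_zPow_zero, inner_self_eq_norm_sq_to_K, hf]; simp
    · exact h n hn
  have hcont (κ : Measure UnitAddCircle) [IsFiniteMeasure κ] :
      Continuous fun g : C(UnitAddCircle, ℂ) => ∫ t, g t ∂κ := by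
    have h3 : Continuous fun g : C(UnitAddCircle, ℂ) =>
        ∫ t, (ContinuousMap.toLp (E := ℂ) 1 κ ℂ g) t ∂κ :=
      continuous_integral.comp (ContinuousMap.toLp (E := ℂ) 1 κ ℂ).continuous
    refine h3.congr fun g => integral_congr_ae (ContinuousMap.coeFn_toLp κ g)
  have hii (κ : Measure UnitAddCircle) [IsFiniteMeasure κ] (g : C(UnitAddCircle, ℂ)) :
      Integrable g κ := g.continuous.integrable_of_hasCompactSupport
        (HasCompactSupport.of_compactSpace _)
  have hall (g : C(UnitAddCircle, ℂ)) : ∫ t, g t ∂ν = ∫ t, g t ∂haarAddCircle := by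
    have hg : g ∈ (Submodule.span ℂ (Set.range (@fourier 1))).topologicalClosure := by
      rw [span_fourier_closure_eq_top]; trivial
    refine closure_minimal (fun k hk => ?_) (isClosed_eq (hcont ν) (hcont haarAddCircle)) hg
    induction hk using Submodule.span_induction with
    | mem x hx => obtain ⟨n, rfl⟩ := hx; exact hfour n
    | zero => simp
    | add x y _ _ hx hy =>
      simp only [Set.mem_ofPred_eq, ContinuousMap.add_apply] at hx hy ⊢
      rw [integral_add (hii _ _) (hii _ _), integral_add (hii _ _) (hii _ _), hx, hy]
    | smul a x _ hx =>
      simp only [Set.mem_ofPred_eq, ContinuousMap.smul_apply] at hx ⊢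
      rw [integral_smul, integral_smul, hx]
  have hνμ : ν = haarAddCircle := by
    apply ext_of_forall_integral_eq_of_IsFiniteMeasure
    intro g
    have := hall ⟨fun t => (g t : ℂ), by fun_prop⟩
    simp only [ContinuousMap.coe_mk] at this
    rw [integral_complex_ofReal, integral_complex_ofReal] at this
    exact_mod_cast this
  have hae : (fun t => (w t : ℝ≥0∞)) =ᵐ[(haarAddCircle : Measure UnitAddCircle)] 1 := by
    refine (withDensity_eq_iff (g := 1) hwm.coe_nnreal_ennreal.aemeasurable
      measurable_one.aemeasurable hfin).mp ?_
    rw [withDensity_one, ← hν, hνμ]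
  filter_upwards [hae] with t ht
  rw [Pi.one_apply, ENNReal.coe_eq_one] at ht
  have hsq : ‖f t‖ ^ 2 = 1 := congrArg NNReal.toReal ht
  exact (pow_eq_one_iff_of_nonneg (norm_nonneg _) two_ne_zero).mp hsq

/-! ### The real Beurling theorem. -/

theorem mulL2_zPow_mem_of_invariant {N : Submodule ℝ (CircleLp 2)}
    (hz : N.map (mulL2 (zPow ∞ 1)) ≤ N) (n : ℕ) {f : CircleLp 2} (hf : f ∈ N) :
    mulL2 (zPow ∞ n) f ∈ N := by
  induction n with
  | zero => simpa [mulL2_zPow_zero] using hf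
  | succ n ih =>
    have := hz (Submodule.mem_map_of_mem ih)
    rwa [mulL2_zPow_mulL2_zPow, add_comm] at this

/-- A nonzero subspace of `H²_r` is not contained in its image under multiplication by `z`. -/
theorem exists_mem_notMem_map_zPow_one {N : Submodule ℝ (CircleLp 2)}
    (hN : N ≤ realHardySpace 2) (hne : N ≠ ⊥) : ∃ f ∈ N, f ∉ N.map (mulL2 (zPow ∞ 1)) := by
  classical
  -- Take the least index n at which some element of N has a nonzero coefficient. If that element
  -- were zg with g ∈ N, then g would have a nonzero coefficient at n - 1.
  have hex : ∃ n : ℕ, ∃ f ∈ N, fourierCoeff f (n : ℤ) ≠ 0 := by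
    obtain ⟨f, hf, hf0⟩ := N.ne_bot_iff.mp hne
    by_contra! hcon
    refine hf0 (CircleLp.ext_fourierCoeff fun k => ?_)
    rw [CircleLp.fourierCoeff_zero]
    rcases lt_or_ge k 0 with hk | hk
    · exact (mem_realHardySpace.mp (hN hf)).2 k hk
    · lift k to ℕ using hk
      exact hcon k f hf
  obtain ⟨f, hf, hfn⟩ := Nat.find_spec hex
  refine ⟨f, hf, ?_⟩
  rintro ⟨g, hg, rfl⟩
  rw [fourierCoeff_mulL2_zPow] at hfn
  rcases Nat.eq_zero_or_pos (Nat.find hex) with h0 | hpos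
  · exact hfn ((mem_realHardySpace.mp (hN hg)).2 _ (by omega))
  · refine Nat.find_min hex (Nat.sub_lt hpos one_pos) ⟨g, hg, ?_⟩
    rwa [Nat.cast_pred hpos]

theorem isClosed_map_mulL2_zPow {N : Submodule ℝ (CircleLp 2)}
    (hclosed : IsClosed (N : Set (CircleLp 2))) (m : ℤ) :
    IsClosed (N.map (mulL2 (zPow ∞ m)) : Set (CircleLp 2)) := by
  have : (N.map (mulL2 (zPow ∞ m)) : Set (CircleLp 2)) = mulL2 (zPow ∞ (-m)) ⁻¹' N := by
    ext f
    constructor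
    · rintro ⟨g, hg, rfl⟩
      rwa [Set.mem_preimage, mulL2_zPow_mulL2_zPow, neg_add_cancel, mulL2_zPow_zero]
    · intro hf
      refine ⟨_, hf, ?_⟩
      rw [mulL2_zPow_mulL2_zPow, add_neg_cancel, mulL2_zPow_zero]
  rw [this]
  exact hclosed.preimage (continuous_mulL2 _)

/-- A closed proper subspace of a subspace has a unit vector of the latter orthogonal to it. -/
theorem exists_norm_eq_one_forall_inner_eq_zero {E : Type*} [NormedAddCommGroup E]
    [InnerProductSpace ℝ E] [CompleteSpace E] {K N : Submodule ℝ E} (hK : IsClosed (K : Set E))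
    (hKN : K ≤ N) {f : E} (hf : f ∈ N) (hfK : f ∉ K) :
    ∃ u ∈ N, ‖u‖ = 1 ∧ ∀ g ∈ K, inner ℝ u g = 0 := by
  have : CompleteSpace K := hK.completeSpace_coe
  set v : E := f - K.starProjection f
  have hv : v ∈ Kᗮ := Submodule.sub_starProjection_mem_orthogonal f
  have hvN : v ∈ N := N.sub_mem hf (hKN (Submodule.starProjection_apply_mem K f))
  have hv0 : v ≠ 0 := fun h => hfK (by
    rw [sub_eq_zero.mp h]
    exact Submodule.starProjection_apply_mem K f)
  refine ⟨‖v‖⁻¹ • v, N.smul_mem _ hvN, ?_, fun g hg => ?_⟩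
  · rw [norm_smul, norm_inv, norm_norm, inv_mul_cancel₀ (norm_ne_zero_iff.mpr hv0)]
  · rw [real_inner_smul_left, (Submodule.mem_orthogonal' K v).mp hv g hg, mul_zero]

/-- The real Beurling theorem: the nonzero closed `z`-invariant subspaces of `H²_r` are the
`φ H²_r` with `φ ∈ H^∞_r` inner. -/
theorem exists_inner_eq_map_realHardySpace {N : Submodule ℝ (CircleLp 2)}
    (hN : N ≤ realHardySpace 2) (hclosed : IsClosed (N : Set (CircleLp 2)))
    (hz : N.map (mulL2 (zPow ∞ 1)) ≤ N) (hne : N ≠ ⊥) :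
    ∃ φ ∈ realHardySpace ∞, IsInnerFunction φ ∧ N = (realHardySpace 2).map (mulL2 φ) := by
  obtain ⟨f₀, hf₀, hf₀z⟩ := exists_mem_notMem_map_zPow_one hN hne
  obtain ⟨u, huN, hu1, huz⟩ :=
    exists_norm_eq_one_forall_inner_eq_zero (isClosed_map_mulL2_zPow hclosed 1) hz hf₀ hf₀z
  have huR := mem_realHardySpace.mp (hN huN)
  have horth (n : ℕ) (hn : n ≠ 0) (g : CircleLp 2) (hg : g ∈ N) :
      inner ℂ u (mulL2 (zPow ∞ n) g) = 0 := by
    apply Complex.ext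
    · rw [← realInner_eq_re, Complex.zero_re]
      refine huz _ ⟨mulL2 (zPow ∞ (n - 1 : ℕ)) g, mulL2_zPow_mem_of_invariant hz _ hg, ?_⟩
      rw [mulL2_zPow_mulL2_zPow]
      congr 3
      omega
    · exact inner_im_eq_zero huR.1
        (mem_realHardySpace.mp (hN (mulL2_zPow_mem_of_invariant hz n hg))).1
  have hu : ∀ᵐ t ∂(haarAddCircle : Measure UnitAddCircle), ‖u t‖ = 1 := by
    refine ae_norm_eq_one_of_inner_eq_zero hu1 fun n hn => ?_
    obtain ⟨k, rfl | rfl⟩ := n.eq_nat_or_neg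
    · exact horth k (by omega) u huN
    · rw [inner_mulL2_zPow, neg_neg, ← inner_conj_symm, horth k (by omega) u huN, map_zero]
  have hmem : MemLp u ∞ haarAddCircle :=
    memLp_top_of_bound (Lp.aestronglyMeasurable u) 1 (hu.mono fun t ht => ht.le)
  set φ : CircleLp ∞ := hmem.toLp u
  have hφu : φ =ᵐ[haarAddCircle] u := hmem.coeFn_toLp
  have hφ1 : ∀ᵐ t ∂(haarAddCircle : Measure UnitAddCircle), ‖φ t‖ = 1 := by
    filter_upwards [hφu, hu] with t h1 h2
    rw [h1, h2]
  have hφz (n : ℤ) : mulL2 φ (zPow 2 n) = mulL2 (zPow ∞ n) u := by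
    apply Lp.ext
    filter_upwards [coeFn_mulL2 φ (zPow 2 n), coeFn_mulL2 (zPow ∞ n) u, coeFn_zPow 2 n,
      coeFn_zPow ∞ n, hφu] with t h1 h2 h3 h4 h5
    rw [h1, h2, h3, h4, h5, mul_comm]
  have hφR : φ ∈ realHardySpace ∞ := by
    rw [mem_realHardySpace]
    simp_rw [fourierCoeff_congr_ae hφu]
    exact huR
  refine ⟨φ, hφR, ⟨hφR.2, hφ1⟩, le_antisymm (fun f hf => ?_) ?_⟩
  -- Since |φ| = 1, multiplication by the conjugate ψ of φ inverts multiplication by φ; it remains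
  -- to place ψf in H²_r.
  · have hmemc : MemLp (fun t => (starRingEnd ℂ) (φ t)) ∞ haarAddCircle :=
      (Lp.memLp φ).star
    set ψ : CircleLp ∞ := hmemc.toLp _
    have hfg : mulL2 φ (mulL2 ψ f) = f := by
      apply Lp.ext
      filter_upwards [coeFn_mulL2 φ (mulL2 ψ f), coeFn_mulL2 ψ f, hmemc.coeFn_toLp, hφ1]
        with t h1 h2 h3 h4
      rw [h1, h2, h3, ← mul_assoc, Complex.mul_conj, Complex.normSq_eq_norm_sq, h4]
      simp
    have hcoef (n : ℤ) : fourierCoeff (mulL2 ψ f) n = inner ℂ (mulL2 (zPow ∞ n) u) f := by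
      rw [fourierCoeff_eq_inner, ← inner_mulL2_of_norm_eq_one hφ1, hfg, hφz]
    refine ⟨mulL2 ψ f, mem_realHardySpace.mpr ⟨fun n => ?_, fun n hn => ?_⟩, hfg⟩
    · rw [hcoef]
      refine inner_im_eq_zero (fun k => ?_) (mem_realHardySpace.mp (hN hf)).1
      rw [fourierCoeff_mulL2_zPow]
      exact huR.1 _
    -- For n < 0 the coefficient is the inner product of u with z^(-n) f, which lies in zN.
    · rw [hcoef, ← neg_neg n, ← inner_mulL2_zPow]
      obtain ⟨k, hk⟩ := Int.eq_ofNat_of_zero_le (a := -n) (by omega)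
      rw [hk]
      exact horth k (by omega) f hf
  · rintro _ ⟨h, hh, rfl⟩
    have hhR := mem_realHardySpace.mp hh
    have hterm (n : ℤ) : mulL2 φ (fourierCoeff h n • zPow 2 n) ∈ N := by
      rcases lt_or_ge n 0 with hn | hn
      · rw [hhR.2 n hn, zero_smul, map_zero]
        exact N.zero_mem
      · lift n to ℕ using hn
        -- N is only real-linear, so the complex scalar has to be exchanged for its real part.
        have : fourierCoeff h (n : ℤ) • zPow 2 n = (fourierCoeff h (n : ℤ)).re • zPow 2 n := by
          rw [CircleLp.real_smul_eq_coe_smul, Complex.ext (Complex.ofReal_re _)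
            ((Complex.ofReal_im _).trans (hhR.1 n).symm)]
        rw [this, map_smul, hφz]
        exact N.smul_mem _ (mulL2_zPow_mem_of_invariant hz n huN)
    have hsum := (hasSum_fourier_series_L2 h).map (mulL2 φ) (continuous_mulL2 φ)
    exact hclosed.mem_of_tendsto hsum (Filter.Eventually.of_forall fun s =>
      N.sum_mem fun n _ => hterm n)

/-! ### The quotient of H²_r by z²H²_r, and the main theorem. -/

theorem exists_eq_add_mulL2_zPow_two {h : CircleLp 2} (hh : h ∈ realHardySpace 2) :
    ∃ a b : ℝ, ∃ g ∈ realHardySpace 2,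
      h = a • zPow 2 0 + b • zPow 2 1 + mulL2 (zPow ∞ 2) g := by
  have hhR := mem_realHardySpace.mp hh
  set a := (fourierCoeff h 0).re with ha
  set b := (fourierCoeff h 1).re with hb
  set r := h - (a • zPow 2 0 + b • zPow 2 1) with hr
  have hrmem : r ∈ realHardySpace 2 := Submodule.sub_mem _ hh (Submodule.add_mem _
    (Submodule.smul_mem _ _ (zPow_mem_realHardySpace le_rfl))
    (Submodule.smul_mem _ _ (zPow_mem_realHardySpace zero_le_one)))
  have hsum (k : ℤ) : fourierCoeff h k =
      fourierCoeff r k + (a * (if k = 0 then 1 else 0) + b * (if k = 1 then 1 else 0)) := by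
    have : h = r + (a • zPow 2 0 + b • zPow 2 1) := by rw [hr, sub_add_cancel]
    conv_lhs => rw [this]
    rw [CircleLp.fourierCoeff_add, CircleLp.fourierCoeff_add, CircleLp.fourierCoeff_real_smul,
      CircleLp.fourierCoeff_real_smul, fourierCoeff_zPow, fourierCoeff_zPow]
  have hreal (k : ℤ) : ((fourierCoeff h k).re : ℂ) = fourierCoeff h k :=
    Complex.ext (Complex.ofReal_re _) ((Complex.ofReal_im _).trans (hhR.1 k).symm)
  have hr0 : fourierCoeff r 0 = 0 := by
    have := hsum 0
    simpa [ha, hreal] using this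
  have hr1 : fourierCoeff r 1 = 0 := by
    have := hsum 1
    simpa [hb, hreal] using this
  refine ⟨a, b, mulL2 (zPow ∞ (-2)) r, mem_realHardySpace.mpr ⟨fun k => ?_, fun k hk => ?_⟩, ?_⟩
  · rw [fourierCoeff_mulL2_zPow]
    exact (mem_realHardySpace.mp hrmem).1 _
  · rw [fourierCoeff_mulL2_zPow]
    rcases (by omega : k - -2 = 0 ∨ k - -2 = 1 ∨ k - -2 < 0) with h0 | h0 | h0
    · rw [h0, hr0]
    · rw [h0, hr1]
    · exact (mem_realHardySpace.mp hrmem).2 _ h0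
  · rw [mulL2_zPow_mulL2_zPow, add_neg_cancel, mulL2_zPow_zero, hr, add_sub_cancel]

theorem inner_span_map_zPow_two_eq_zero (c : ℝ) {f g : CircleLp 2}
    (hf : f ∈ Submodule.span ℝ {zPow 2 0 + c • zPow 2 1})
    (hg : g ∈ (realHardySpace 2).map (mulL2 (zPow ∞ 2))) : inner ℂ f g = 0 := by
  obtain ⟨a, rfl⟩ := Submodule.mem_span_singleton.mp hf
  obtain ⟨h, hh, rfl⟩ := hg
  have hneg := (mem_realHardySpace.mp hh).2
  rw [CircleLp.real_smul_eq_coe_smul a, CircleLp.real_smul_eq_coe_smul c, inner_smul_left, inner_add_left,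
    inner_smul_left, ← fourierCoeff_eq_inner, ← fourierCoeff_eq_inner, fourierCoeff_mulL2_zPow,
    fourierCoeff_mulL2_zPow, hneg _ (by norm_num), hneg _ (by norm_num)]
  simp

theorem mainTheorem12 (M : Submodule ℝ (CircleLp 2))
    (hM : M ≤ realHardySpace 2)
    (hclosed : IsClosed (M : Set (CircleLp 2)))
    (h2 : M.map (mulL2 (zPow ∞ 2)) ≤ M)
    (h3 : M.map (mulL2 (zPow ∞ 3)) ≤ M)
    (h1 : ¬ M.map (mulL2 (zPow ∞ 1)) ≤ M) :
    ∃ (c : ℝ) (φ : CircleLp ∞),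
      φ ∈ realHardySpace ∞ ∧ IsInnerFunction φ ∧
      (∀ f ∈ Submodule.span ℝ {zPow 2 0 + c • zPow 2 1},
        ∀ g ∈ (realHardySpace 2).map (mulL2 (zPow ∞ 2)), inner ℂ f g = 0) ∧
      M = (Submodule.span ℝ {zPow 2 0 + c • zPow 2 1} ⊔
        (realHardySpace 2).map (mulL2 (zPow ∞ 2))).map (mulL2 φ) := by
  -- The closure `N` of `M + zM` is `z`-invariant and satisfies `z²N ⊆ M ⊆ N`.
  set N := (M ⊔ M.map (mulL2 (zPow ∞ 1))).topologicalClosure with hNdef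
  have hMN : M ≤ N := le_sup_left.trans (Submodule.le_topologicalClosure _)
  have hNR : N ≤ realHardySpace 2 := by
    refine Submodule.topologicalClosure_minimal _ (sup_le hM ?_) isClosed_realHardySpace
    rintro _ ⟨f, hf, rfl⟩
    exact mulL2_zPow_mem_realHardySpace zero_le_one (hM hf)
  have hNcl : IsClosed (N : Set (CircleLp 2)) := Submodule.isClosed_topologicalClosure _
  have hNz : N.map (mulL2 (zPow ∞ 1)) ≤ N := by
    rw [Submodule.map_le_iff_le_comap]
    refine Submodule.topologicalClosure_minimal _ (sup_le ?_ ?_)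
      (hNcl.preimage (continuous_mulL2 _))
    · rw [← Submodule.map_le_iff_le_comap]
      exact le_sup_right.trans (Submodule.le_topologicalClosure _)
    · rintro _ ⟨f, hf, rfl⟩
      rw [Submodule.mem_comap, mulL2_zPow_mulL2_zPow]
      exact hMN (h2 (Submodule.mem_map_of_mem hf))
  have hN2 : N.map (mulL2 (zPow ∞ 2)) ≤ M := by
    rw [Submodule.map_le_iff_le_comap]
    refine Submodule.topologicalClosure_minimal _ (sup_le ?_ ?_)
      (hclosed.preimage (continuous_mulL2 _))
    · rwa [← Submodule.map_le_iff_le_comap]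
    · rintro _ ⟨f, hf, rfl⟩
      rw [Submodule.mem_comap, mulL2_zPow_mulL2_zPow]
      exact h3 (Submodule.mem_map_of_mem hf)
  have hNne : N ≠ ⊥ := by
    intro h
    have hM0 : M = ⊥ := le_bot_iff.mp (h ▸ hMN)
    exact h1 (by rw [hM0, Submodule.map_bot])
  obtain ⟨φ, hφR, hφ, hN⟩ := exists_inner_eq_map_realHardySpace hNR hNcl hNz hNne
  have hsub {g : CircleLp 2} (hg : g ∈ realHardySpace 2) :
      mulL2 φ (mulL2 (zPow ∞ 2) g) ∈ M := by
    rw [mulL2_comm]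
    exact hN2 (Submodule.mem_map_of_mem (hN ▸ Submodule.mem_map_of_mem hg))
  have hdecomp {f : CircleLp 2} (hf : f ∈ M) : ∃ a b : ℝ, ∃ g ∈ realHardySpace 2,
      f = mulL2 φ (a • zPow 2 0 + b • zPow 2 1 + mulL2 (zPow ∞ 2) g) := by
    have hfN := hMN hf
    rw [hN] at hfN
    obtain ⟨h, hh, rfl⟩ := hfN
    obtain ⟨a, b, g, hg, rfl⟩ := exists_eq_add_mulL2_zPow_two hh
    exact ⟨a, b, g, hg, rfl⟩
  obtain ⟨_, ⟨m, hm, rfl⟩, hzm⟩ := SetLike.not_le_iff_exists.mp h1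
  obtain ⟨a, b, g, hg, rfl⟩ := hdecomp hm
  -- Here zm = aφz + φz²(b + zg), and the last term is in M. This one fact yields both a ≠ 0 and φz
  -- ∉ M.
  have hza : a • mulL2 φ (zPow 2 1) ∉ M := by
    intro ha
    refine hzm ?_
    have hrest := hsub (Submodule.add_mem _
      (Submodule.smul_mem _ b (zPow_mem_realHardySpace le_rfl))
      (mulL2_zPow_mem_realHardySpace zero_le_one hg))
    convert! M.add_mem ha hrest using 1
    rw [mulL2_comm, ← map_smul, ← map_add]
    congr 1
    simp only [map_add, map_smul, mulL2_zPow_zPow, mulL2_zPow_mulL2_zPow]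
    norm_num [add_assoc]
  have ha0 : a ≠ 0 := fun h => hza (by rw [h, zero_smul]; exact M.zero_mem)
  have hz1 : mulL2 φ (zPow 2 1) ∉ M := fun h => hza (M.smul_mem a h)
  have hgen : mulL2 φ (zPow 2 0 + (b / a) • zPow 2 1) ∈ M := by
    have := M.smul_mem a⁻¹ (M.sub_mem hm (hsub hg))
    rw [← map_sub, add_sub_cancel_right, ← map_smul, smul_add, smul_smul, smul_smul,
      inv_mul_cancel₀ ha0, one_smul] at this
    rwa [div_eq_inv_mul]
  refine ⟨b / a, φ, hφR, hφ, fun f hf g hg => inner_span_map_zPow_two_eq_zero _ hf hg,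
    le_antisymm (fun f hf => ?_) ?_⟩
  · obtain ⟨a₂, b₂, g₂, hg₂, rfl⟩ := hdecomp hf
    -- Removing the φz²H²_r part and a₂ times the generator leaves a multiple of φz in M, so its
    -- coefficient must vanish.
    have hdiff : (b₂ - a₂ * (b / a)) • mulL2 φ (zPow 2 1) ∈ M := by
      convert! M.sub_mem (M.sub_mem hf (hsub hg₂)) (M.smul_mem a₂ hgen) using 1
      rw [← map_smul, ← map_smul, ← map_sub, ← map_sub]
      congr 1
      module
    have hb₂ : b₂ = a₂ * (b / a) := by
      by_contra hne
      exact hz1 ((M.smul_mem_iff (sub_ne_zero.mpr hne)).mp hdiff)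
    refine Submodule.mem_map_of_mem (Submodule.add_mem_sup ?_ (Submodule.mem_map_of_mem hg₂))
    refine Submodule.mem_span_singleton.mpr ⟨a₂, ?_⟩
    rw [hb₂, smul_add, smul_smul]
  · rw [Submodule.map_sup, sup_le_iff, Submodule.map_span, Submodule.span_le]
    constructor
    · rintro _ ⟨_, rfl, rfl⟩
      exact hgen
    · rintro _ ⟨_, ⟨g₂, hg₂, rfl⟩, rfl⟩
      exact hsub hg₂
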